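/- Let $\mathbb S^2\subset\mathbb R^3$ be the unit sphere with surface measure $dS$ (total area $4\pi$), and let $\nabla$ denote the (weak) gradient on $\mathbb S^2$. Let $\psi_1,\dots,\psi_N\in H^1(\mathbb S^2)$ be real-valued functions that are orthonormal in $L^2(\mathbb S^2)$ and have zero mean, that is, $$\int_{\mathbb S^2}\psi_i\psi_j\,dS=\delta_{ij},\qquad \int_{\mathbb S^2}\psi_j\,dS=0\qquad(1\le i,j\le N).$$ Then $\rho(s):=\sum_{j=1}^N\psi_j(s)^2$ belongs to $L^2(\mathbb S^2)$ and satisfies $$\int_{\mathbb S^2}\rho(s)^2\,dS\le\frac{9}{4\pi}\sum_{j=1}^N\int_{\mathbb S^2}|\nabla\psi_j|^2\,dS.$$ -/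

import Mathlib

open MeasureTheory
open scoped ContDiff

namespace SphereLT

/-- Euclidean three-space. -/
abbrev E3 : Type := EuclideanSpace ℝ (Fin 3)

/-- The unit sphere `𝕊²` in Euclidean three-space. -/
abbrev S2 : Type := Metric.sphere (0 : E3) 1

/-- The surface measure `dS` on `𝕊²` (polar decomposition of Lebesgue measure, total mass `4π`). -/
noncomputable abbrev dS : Measure S2 := (volume : Measure E3).toSphere

/-- A smooth tangent vector field on `𝕊²`, given by a smooth extension to the ambient space. -/
structure IsTangentField (X : E3 → E3) : Prop where
  smooth : ContDiff ℝ ∞ X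
  tangent : ∀ s : S2, inner ℝ (X s) (s : E3) = 0

/-- The surface divergence of `X` at a point `s` of the sphere: the trace of the derivative of `X`
over the tangent plane `s^⊥`, that is, the full trace minus the normal component. It involves
only derivatives of `X` in tangential directions, hence only the values of `X` on the sphere. -/
noncomputable def surfaceDiv (X : E3 → E3) (s : S2) : ℝ :=
  (∑ i : Fin 3, (fderiv ℝ X s (EuclideanSpace.single i 1)) i)
    - inner ℝ (fderiv ℝ X s (s : E3)) (s : E3)

/-- `G` is an `L²` weak (distributional) gradient of `f` on the sphere: a square-integrable
tangent vector field with `∫ f div X dS = - ∫ G · X dS` for every smooth tangent field `X`. -/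
structure IsWeakGradient (f : S2 → ℝ) (G : S2 → E3) : Prop where
  memLp : MemLp G 2 dS
  tangent : ∀ᵐ s ∂dS, inner ℝ (G s) (s : E3) = 0
  integral_eq : ∀ X : E3 → E3, IsTangentField X →
    ∫ s, f s * surfaceDiv X s ∂dS = - ∫ s, inner ℝ (G s) (X s) ∂dS

/-- The Sobolev space `H¹(𝕊²)`: square-integrable functions with a square-integrable weak
gradient. -/
def MemH1 (f : S2 → ℝ) : Prop :=
  MemLp f 2 dS ∧ ∃ G : S2 → E3, IsWeakGradient f G

end SphereLT

namespace SphereLT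

/-! Let `P_n` be the orthogonal projection of `L²` onto restrictions of polynomials of degree at
most `n`. Rotation invariance and `dim ≤ (n+1)²` bound the diagonal of its kernel by `(n+1)²/4π`;
zero means allow the constants to be removed, so Bessel gives `∑ |P_n ψ_j|² ≤ n(n+2)/4π` pointwise
(`sum_sq_projection_le`). By the triangle inequality in `ℝ^N`, `(√ρ - √(n(n+2)/4π))₊² ≤ ∑ |ψ_j - P_n
ψ_j|²`. Sum this over `n` with weights `2(n+1)`, the gaps of the spectrum `n(n+1)`. On the right,
the integral is at most the Dirichlet energy (`sum_norm_sub_projection_le`). On the left, a Riemann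
sum of a decreasing function bounds `ρ²/(6c)` from above, with `c = 3/8π` (`pow_four_le_sum`); and
`6c = 9/4π`. Spherical harmonics are not constructed: the Laplacian acts on polynomials through
infinitesimal rotations, and the explicit test fields `gradField` link it to weak gradients. -/

open MvPolynomial Filter Topology

/-! ### Algebra of the spherical Laplacian on polynomials. -/

/-- Real polynomials in three variables. -/
abbrev Pol : Type := MvPolynomial (Fin 3) ℝ

/-- Restriction of polynomials to the sphere. -/
noncomputable def ev : Pol →ₐ[ℝ] C(S2, ℝ) :=
  aeval fun i => (⟨fun s : S2 => (s : E3) i, by fun_prop⟩ : C(S2, ℝ))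

theorem ev_apply (p : Pol) (s : S2) : ev p s = eval (fun i => (s : E3) i) p := by
  induction p using MvPolynomial.induction_on with
  | C a => simp [ev]
  | add p q hp hq => simp [hp, hq]
  | mul_X p i hp => simp [hp]; simp [ev]

/-- The squared radius `x² + y² + z²`. -/
noncomputable def radiusSq : Pol := ∑ i, X i ^ 2

theorem ev_radiusSq : ev radiusSq = 1 := by
  ext s
  have h : ‖(s : E3)‖ = 1 := by simp
  have h2 := EuclideanSpace.real_norm_sq_eq (s : E3)
  rw [h] at h2
  simp [ev_apply, radiusSq, ← h2]

/-- The infinitesimal rotation `xᵢ ∂ⱼ - xⱼ ∂ᵢ`. -/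
noncomputable def rot (i j : Fin 3) : Derivation ℝ Pol Pol :=
  (X i : Pol) • pderiv j - (X j : Pol) • pderiv i

theorem rot_apply (i j : Fin 3) (p : Pol) : rot i j p = X i * pderiv j p - X j * pderiv i p := by
  simp [rot]

/-- The Euler operator `∑ xᵢ ∂ᵢ`. -/
noncomputable def euler : Derivation ℝ Pol Pol := ∑ i, (X i : Pol) • pderiv i

theorem euler_apply (p : Pol) : euler p = ∑ i, X i * pderiv i p := by
  simp [euler, Fin.sum_univ_three]

/-- The flat Laplacian. -/
noncomputable def lap (p : Pol) : Pol := ∑ i, pderiv i (pderiv i p)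

/-- The spherical Laplacian as the sum of the squares of the infinitesimal rotations. -/
noncomputable def lapS : Pol →ₗ[ℝ] Pol :=
  (rot 0 1).toLinearMap ∘ₗ (rot 0 1).toLinearMap + (rot 1 2).toLinearMap ∘ₗ (rot 1 2).toLinearMap
    + (rot 2 0).toLinearMap ∘ₗ (rot 2 0).toLinearMap

theorem lapS_apply (p : Pol) :
    lapS p = rot 0 1 (rot 0 1 p) + rot 1 2 (rot 1 2 p) + rot 2 0 (rot 2 0 p) := rfl

theorem pderiv_comm (i j : Fin 3) (p : Pol) : pderiv i (pderiv j p) = pderiv j (pderiv i p) := by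
  have h : ⁅(pderiv i : Derivation ℝ Pol Pol), (pderiv j : Derivation ℝ Pol Pol)⁆ = 0 := by
    apply MvPolynomial.derivation_ext
    intro k
    rw [Derivation.commutator_apply]
    simp [pderiv_X, Pi.single_apply, apply_ite]
  have := congrArg (fun D => D p) h
  simpa [Derivation.commutator_apply, sub_eq_zero] using this

/-- Polar form of the flat Laplacian, with radial part `E² + E` for the Euler operator `E`. -/
theorem lapS_eq (p : Pol) : lapS p = radiusSq * lap p - euler (euler p) - euler p := by
  simp only [lapS_apply, rot_apply, euler_apply, lap, radiusSq, Fin.sum_univ_three, map_sub, map_add,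
    pderiv_mul, pderiv_X_self, pderiv_X_of_ne (show (0 : Fin 3) ≠ 1 by decide),
    pderiv_X_of_ne (show (0 : Fin 3) ≠ 2 by decide), pderiv_X_of_ne (show (1 : Fin 3) ≠ 2 by decide),
    pderiv_X_of_ne (show (1 : Fin 3) ≠ 0 by decide), pderiv_X_of_ne (show (2 : Fin 3) ≠ 0 by decide),
    pderiv_X_of_ne (show (2 : Fin 3) ≠ 1 by decide)]
  rw [pderiv_comm 1 0, pderiv_comm 2 0, pderiv_comm 2 1]
  ring

theorem totalDegree_induction {n : ℕ} {P : Pol → Prop} (zero : P 0)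
    (add : ∀ p q, P p → P q → P (p + q))
    (hom : ∀ k ≤ n, ∀ p : Pol, p.IsHomogeneous k → P p) {p : Pol} (hp : p.totalDegree ≤ n) :
    P p := by
  rw [← sum_homogeneousComponent p]
  refine Finset.sum_induction _ P add zero fun k hk => ?_
  have := Finset.mem_range.1 hk
  exact hom k (by omega) _ (homogeneousComponent_isHomogeneous k p)

theorem IsHomogeneous.X_mul_pderiv {k : ℕ} {p : Pol} (hp : p.IsHomogeneous k) (i j : Fin 3) :
    (X i * pderiv j p : Pol).IsHomogeneous k := by
  rcases k with _ | k
  · rw [← totalDegree_zero_iff_isHomogeneous, totalDegree_eq_zero_iff_eq_C] at hp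
    rw [hp]
    simpa using isHomogeneous_zero (Fin 3) ℝ 0
  · have := (isHomogeneous_X ℝ i).mul (hp.pderiv (i := j))
    rwa [Nat.add_sub_cancel, add_comm] at this

theorem IsHomogeneous.rot {k : ℕ} {p : Pol} (hp : p.IsHomogeneous k) (i j : Fin 3) :
    (rot i j p).IsHomogeneous k := by
  rw [rot_apply]
  exact (IsHomogeneous.X_mul_pderiv hp i j).sub (IsHomogeneous.X_mul_pderiv hp j i)

theorem totalDegree_add_le' {n : ℕ} {p q : Pol} (hp : p.totalDegree ≤ n) (hq : q.totalDegree ≤ n) :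
    (p + q).totalDegree ≤ n := (totalDegree_add p q).trans (max_le hp hq)

theorem totalDegree_rot_le {n : ℕ} (i j : Fin 3) {p : Pol} (hp : p.totalDegree ≤ n) :
    (rot i j p).totalDegree ≤ n := by
  refine totalDegree_induction (P := fun p => (rot i j p).totalDegree ≤ n) (by simp)
    (fun p q hp hq => ?_) (fun k hk p hp => ?_) hp
  · rw [map_add]
    exact totalDegree_add_le' hp hq
  · exact (IsHomogeneous.rot hp i j).totalDegree_le.trans hk

theorem totalDegree_lapS_le {n : ℕ} {p : Pol} (hp : p.totalDegree ≤ n) :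
    (lapS p).totalDegree ≤ n := by
  rw [lapS_apply]
  exact totalDegree_add_le' (totalDegree_add_le' (totalDegree_rot_le _ _ (totalDegree_rot_le _ _ hp))
    (totalDegree_rot_le _ _ (totalDegree_rot_le _ _ hp)))
    (totalDegree_rot_le _ _ (totalDegree_rot_le _ _ hp))

theorem IsHomogeneous.euler_eq {k : ℕ} {p : Pol} (hp : p.IsHomogeneous k) :
    euler p = (k : ℝ) • p := by
  rw [euler_apply, hp.sum_X_mul_pderiv, Nat.cast_smul_eq_nsmul]

theorem IsHomogeneous.lapS_add {k : ℕ} {p : Pol} (hp : p.IsHomogeneous k) :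
    lapS p + ((k : ℝ) * (k + 1)) • p = radiusSq * lap p := by
  rw [lapS_eq, IsHomogeneous.euler_eq hp, Derivation.map_smul, IsHomogeneous.euler_eq hp, smul_smul,
    mul_add, add_smul, mul_one]
  abel

theorem IsHomogeneous.totalDegree_lap_le {m : ℕ} {p : Pol} (hp : p.IsHomogeneous (m + 1)) :
    (lap p).totalDegree ≤ m := by
  have : (lap p).IsHomogeneous (m - 1) := by
    refine IsHomogeneous.sum _ _ _ fun i _ => ?_
    exact (hp.pderiv (i := i)).pderiv (i := i)
  exact this.totalDegree_le.trans (by omega)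

/-- Modulo degree at most `m`, `lapS` is a scalar: on the top component the sum is `|x|² Δp`, which
restricts to `Δp`, of lower degree. -/
theorem exists_ev_lapS_add {m : ℕ} {p : Pol} (hp : p.totalDegree ≤ m + 1) :
    ∃ u : Pol, u.totalDegree ≤ m ∧ ev (lapS p + (((m : ℝ) + 1) * (m + 2)) • p) = ev u := by
  refine totalDegree_induction (P := fun p => ∃ u : Pol, u.totalDegree ≤ m ∧
    ev (lapS p + (((m : ℝ) + 1) * (m + 2)) • p) = ev u) ⟨0, by simp, by simp⟩ ?_ ?_ hp
  · rintro p q ⟨u, hu, hu'⟩ ⟨v, hv, hv'⟩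
    refine ⟨u + v, totalDegree_add_le' hu hv, ?_⟩
    rw [map_add ev u v, ← hu', ← hv', ← map_add, map_add lapS, smul_add]
    congr 1
    abel
  · intro k hk p hp
    rcases hk.lt_or_eq with h | rfl
    · have hp' : p.totalDegree ≤ m := hp.totalDegree_le.trans (by omega)
      exact ⟨_, totalDegree_add_le' (totalDegree_lapS_le hp') ((totalDegree_smul_le _ _).trans hp'),
        rfl⟩
    · refine ⟨lap p, IsHomogeneous.totalDegree_lap_le hp, ?_⟩
      have := IsHomogeneous.lapS_add hp
      push_cast at this
      rw [show (m : ℝ) + 2 = m + 1 + 1 by ring, this, map_mul, ev_radiusSq, one_mul]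

/-! ### Calculus of polynomial functions, rotations and integration by parts. -/

/-- Polynomials as functions on Euclidean space. -/
noncomputable def fn (p : Pol) (x : E3) : ℝ := eval (fun i => x i) p

theorem fn_coe (p : Pol) (s : S2) : fn p s = ev p s := (ev_apply p s).symm

theorem fn_add (p q : Pol) (x : E3) : fn (p + q) x = fn p x + fn q x := by simp [fn]
theorem fn_sub (p q : Pol) (x : E3) : fn (p - q) x = fn p x - fn q x := by simp [fn]
theorem fn_mul (p q : Pol) (x : E3) : fn (p * q) x = fn p x * fn q x := by simp [fn]
theorem fn_X (i : Fin 3) (x : E3) : fn (X i) x = x i := by simp [fn]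

theorem hasFDerivAt_fn (p : Pol) (x : E3) :
    HasFDerivAt (fn p) (∑ i, fn (pderiv i p) x • (EuclideanSpace.proj i : E3 →L[ℝ] ℝ)) x := by
  induction p using MvPolynomial.induction_on with
  | C a => 
    have : fn (C a) = fun _ => a := by ext; simp [fn]
    rw [this]
    simpa [fn] using hasFDerivAt_const a x
  | add p q hp hq =>
    have : fn (p + q) = fun x => fn p x + fn q x := by ext; simp [fn]
    rw [this]
    refine (hp.add hq).congr_fderiv ?_
    rw [← Finset.sum_add_distrib]
    simp [fn, add_smul]
  | mul_X p j hp =>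
    have : fn (p * X j) = fun x => fn p x * x j := by ext; simp [fn]
    rw [this]
    refine (hp.mul (EuclideanSpace.proj j : E3 →L[ℝ] ℝ).hasFDerivAt).congr_fderiv ?_
    ext v
    simp [fn, pderiv_X, Pi.single_apply, add_mul, Finset.sum_add_distrib, mul_assoc,
      Finset.mul_sum, apply_ite, ite_mul]

theorem contDiff_fn (p : Pol) : ContDiff ℝ ∞ (fn p) := by
  induction p using MvPolynomial.induction_on with
  | C a => 
    have : fn (C a) = fun _ => a := by ext; simp [fn]
    rw [this]
    exact contDiff_const
  | add p q hp hq =>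
    have : fn (p + q) = fun x => fn p x + fn q x := by ext; simp [fn]
    rw [this]
    exact hp.add hq
  | mul_X p j hp =>
    have : fn (p * X j) = fun x => fn p x * x j := by ext; simp [fn]
    rw [this]
    exact hp.mul (EuclideanSpace.proj j : E3 →L[ℝ] ℝ).contDiff

/-- The action of a linear isometry on the sphere. -/
noncomputable def sphereMap (R : E3 ≃ₗᵢ[ℝ] E3) : C(S2, S2) where
  toFun s := ⟨R s, by simp⟩
  continuous_toFun := by fun_prop

theorem coe_sphereMap (R : E3 ≃ₗᵢ[ℝ] E3) (s : S2) : (sphereMap R s : E3) = R s := rfl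

/-- Surface measure is defined through the volume of cones, and `R` maps cones to cones preserving
volume. -/
theorem measurePreserving_sphereMap (R : E3 ≃ₗᵢ[ℝ] E3) : MeasurePreserving (sphereMap R) dS dS := by
  have hm : Measurable (sphereMap R) := (sphereMap R).continuous.measurable
  refine ⟨hm, Measure.ext fun s hs => ?_⟩
  rw [Measure.map_apply hm hs, Measure.toSphere_apply' _ hs, Measure.toSphere_apply' _ (hm hs)]
  congr 1
  conv_rhs => rw [← R.measurePreserving.measure_preimage_emb R.toHomeomorph.measurableEmbedding]
  congr 1
  ext x
  simp only [Set.mem_smul, Set.mem_image, Set.mem_preimage]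
  constructor
  · rintro ⟨r, hr, _, ⟨y, hy, rfl⟩, rfl⟩
    exact ⟨r, hr, _, ⟨_, hy, rfl⟩, by simp [coe_sphereMap]⟩
  · rintro ⟨r, hr, _, ⟨y, hy, rfl⟩, h⟩
    refine ⟨r, hr, _, ⟨sphereMap R.symm y, ?_, rfl⟩, ?_⟩
    · have : sphereMap R (sphereMap R.symm y) = y := by
        apply Subtype.ext; simp [coe_sphereMap]
      rwa [this]
    · apply R.injective
      rw [map_smul, coe_sphereMap, R.apply_symm_apply, ← h]

theorem integral_comp_sphereMap (R : E3 ≃ₗᵢ[ℝ] E3) (f : C(S2, ℝ)) :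
    ∫ s, f (sphereMap R s) ∂dS = ∫ s, f s ∂dS := by
  have h := measurePreserving_sphereMap R
  conv_rhs => rw [← h.map_eq]
  exact (integral_map h.measurable.aemeasurable f.continuous.aestronglyMeasurable).symm

theorem dS_real_univ : dS.real Set.univ = 4 * Real.pi := by
  rw [Measure.toSphere_real_apply_univ, measureReal_def, EuclideanSpace.volume_ball_fin_three]
  have : 0 ≤ Real.pi * 4 / 3 := by positivity
  simp [ENNReal.toReal_ofReal this]
  ring

theorem integrable_continuousMap (f : C(S2, ℝ)) : Integrable (fun s => f s) dS :=
  f.continuous.integrable_of_hasCompactSupport (HasCompactSupport.of_compactSpace _)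

/-- The rotation by the angle `t` in the plane of the coordinates `i` and `j`. -/
noncomputable def rotation {i j : Fin 3} (h : i ≠ j) (t : ℝ) : E3 ≃ₗᵢ[ℝ] E3 :=
  LinearIsometry.toLinearIsometryEquiv
    { toFun := fun v => v
        + ((Real.cos t - 1) * v i - Real.sin t * v j) • EuclideanSpace.single i (1 : ℝ)
        + (Real.sin t * v i + (Real.cos t - 1) * v j) • EuclideanSpace.single j (1 : ℝ)
      map_add' := fun v w => by
        simp only [PiLp.add_apply]
        module
      map_smul' := fun c v => by
        simp only [PiLp.smul_apply, smul_eq_mul, RingHom.id_apply]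
        module
      norm_map' := fun v => by
        rw [← sq_eq_sq₀ (norm_nonneg _) (norm_nonneg _), EuclideanSpace.real_norm_sq_eq,
          EuclideanSpace.real_norm_sq_eq, Fin.sum_univ_three, Fin.sum_univ_three]
        have hc := Real.sin_sq_add_cos_sq t
        fin_cases i <;> fin_cases j <;> simp at h ⊢ <;> grind }
    rfl

theorem rotation_apply {i j : Fin 3} (h : i ≠ j) (t : ℝ) (v : E3) : rotation h t v = v
    + ((Real.cos t - 1) * v i - Real.sin t * v j) • EuclideanSpace.single i (1 : ℝ)
    + (Real.sin t * v i + (Real.cos t - 1) * v j) • EuclideanSpace.single j (1 : ℝ) := rfl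

theorem hasDerivAt_fn_rotation {i j : Fin 3} (h : i ≠ j) (p : Pol) (v : E3) (t : ℝ) :
    HasDerivAt (fun t => fn p (rotation h t v)) (fn (rot i j p) (rotation h t v)) t := by
  have h1 : HasDerivAt (fun t => rotation h t v)
      ((-Real.sin t * v i - Real.cos t * v j) • EuclideanSpace.single i (1 : ℝ)
        + (Real.cos t * v i - Real.sin t * v j) • EuclideanSpace.single j (1 : ℝ)) t := by
    simp only [rotation_apply]
    have hc := Real.hasDerivAt_cos t
    have hs := Real.hasDerivAt_sin t
    have ha := ((((hc.sub_const 1).mul_const (v i)).sub (hs.mul_const (v j))).smul_const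
      (EuclideanSpace.single i (1 : ℝ) : E3)).const_add v
    have hb := ((hs.mul_const (v i)).add ((hc.sub_const 1).mul_const (v j))).smul_const
      (EuclideanSpace.single j (1 : ℝ) : E3)
    refine (ha.add hb).congr_deriv ?_
    module
  have h2 := (hasFDerivAt_fn p (rotation h t v)).comp_hasDerivAt t h1
  refine h2.congr_deriv ?_
  rw [rot_apply, fn_sub, fn_mul, fn_mul, fn_X, fn_X]
  simp [h, h.symm, rotation_apply, Finset.sum_add_distrib, mul_add]
  ring

/-- Differentiate the constant `t ↦ ∫ p ∘ R_t` at `0` under the integral sign. -/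
theorem integral_rot {i j : Fin 3} (h : i ≠ j) (p : Pol) : ∫ s, ev (rot i j p) s ∂dS = 0 := by
  have key := (hasDerivAt_integral_of_dominated_loc_of_deriv_le (μ := dS) (𝕜 := ℝ)
    (F := fun t s => fn p (rotation h t (s : E3)))
    (F' := fun t s => fn (rot i j p) (rotation h t (s : E3))) (x₀ := 0) (s := Set.univ)
    (bound := fun _ => ‖ev (rot i j p)‖) Filter.univ_mem ?_ ?_ ?_ ?_ ?_ ?_).2
  · have hconst : (fun t => ∫ s, fn p (rotation h t (s : E3)) ∂dS) =
        fun _ => ∫ s, ev p s ∂dS := by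
      ext t
      rw [← integral_comp_sphereMap (rotation h t)]
      simp_rw [← fn_coe, coe_sphereMap]
    rw [hconst] at key
    have h0 := key.unique (hasDerivAt_const _ _)
    rw [← h0]
    simp [← fn_coe, rotation_apply]
  · refine Filter.Eventually.of_forall fun t => Continuous.aestronglyMeasurable ?_
    exact (contDiff_fn p).continuous.comp ((rotation h t).continuous.comp continuous_subtype_val)
  · have := integrable_continuousMap ((ev p).comp (sphereMap (rotation h 0)))
    simpa [← fn_coe, coe_sphereMap] using this
  · refine Continuous.aestronglyMeasurable ?_
    exact (contDiff_fn _).continuous.comp ((rotation h 0).continuous.comp continuous_subtype_val)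
  · refine Filter.Eventually.of_forall fun s t _ => ?_
    have := (ev (rot i j p)).norm_coe_le_norm (sphereMap (rotation h t) s)
    rwa [← fn_coe, coe_sphereMap] at this
  · exact integrable_const _
  · exact Filter.Eventually.of_forall fun s t _ => hasDerivAt_fn_rotation h p s t

theorem integral_ev_add (p q : Pol) :
    ∫ s, ev (p + q) s ∂dS = ∫ s, ev p s ∂dS + ∫ s, ev q s ∂dS := by
  rw [← integral_add (integrable_continuousMap _) (integrable_continuousMap _)]
  simp

theorem integral_rot_mul {i j : Fin 3} (h : i ≠ j) (p q : Pol) :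
    ∫ s, ev (rot i j p * q) s ∂dS = - ∫ s, ev (p * rot i j q) s ∂dS := by
  have := integral_rot h (p * q)
  rw [Derivation.leibniz, integral_ev_add, smul_eq_mul, smul_eq_mul, mul_comm q] at this
  linarith

/-! ### Dirichlet form and gradient test fields. -/

/-- The Dirichlet form as a polynomial. -/
noncomputable def gradSq (p q : Pol) : Pol :=
  rot 0 1 p * rot 0 1 q + rot 1 2 p * rot 1 2 q + rot 2 0 p * rot 2 0 q

theorem gradSq_comm (p q : Pol) : gradSq p q = gradSq q p := by
  simp only [gradSq]; ring

theorem integral_gradSq (p q : Pol) :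
    ∫ s, ev (gradSq p q) s ∂dS = - ∫ s, ev (p * lapS q) s ∂dS := by
  rw [lapS_apply, gradSq, mul_add, mul_add]
  simp only [integral_ev_add]
  rw [integral_rot_mul (by decide), integral_rot_mul (by decide), integral_rot_mul (by decide)]
  ring

theorem integral_lapS_mul (p q : Pol) :
    ∫ s, ev (lapS p * q) s ∂dS = ∫ s, ev (p * lapS q) s ∂dS := by
  have h1 := integral_gradSq p q
  have h2 := integral_gradSq q p
  rw [gradSq_comm, mul_comm] at h2
  linarith

/-- A polynomial vector field that restricts to the gradient of `q` on the sphere. -/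
noncomputable def gradField (q : Pol) (x : E3) : E3 :=
  WithLp.toLp 2 fun i => fn (radiusSq * pderiv i q - X i * euler q) x

theorem gradField_apply (q : Pol) (x : E3) (i : Fin 3) :
    gradField q x i = fn (radiusSq * pderiv i q - X i * euler q) x := rfl

theorem contDiff_gradField (q : Pol) : ContDiff ℝ ∞ (gradField q) := by
  rw [contDiff_euclidean]
  exact fun i => contDiff_fn _

/-- The factor `radiusSq` makes this hold off the sphere too, so `surfaceDiv_gradField` can
differentiate it radially to remove the normal term. -/
theorem inner_gradField (q : Pol) (x : E3) : inner ℝ (gradField q x) x = 0 := by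
  have : ∑ i, X i * (radiusSq * pderiv i q - X i * euler q) = 0 := by
    simp only [euler_apply, radiusSq, Fin.sum_univ_three]
    ring
  have h2 := congrArg (fun p => fn p x) this
  simp only [Fin.sum_univ_three, fn_add, fn_mul, fn_X] at h2
  simp only [PiLp.inner_apply, Fin.sum_univ_three, gradField_apply]
  simpa [fn] using h2

theorem isTangentField_gradField (q : Pol) : IsTangentField (gradField q) :=
  ⟨contDiff_gradField q, fun s => inner_gradField q s⟩

/-- Lagrange's identity for `x × ∇q`, restricted to `|x| = 1`. -/
theorem norm_gradField_sq (q : Pol) (s : S2) : ‖gradField q s‖ ^ 2 = ev (gradSq q q) s := by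
  have : ∑ i, (radiusSq * pderiv i q - X i * euler q) ^ 2 = radiusSq * gradSq q q := by
    simp only [euler_apply, radiusSq, Fin.sum_univ_three, gradSq, rot_apply]
    ring
  have h2 := congrArg (fun p => ev p s) this
  rw [map_mul, ev_radiusSq, one_mul] at h2
  rw [EuclideanSpace.real_norm_sq_eq, ← h2]
  simp [gradField_apply, fn_coe]

theorem surfaceDiv_gradField (q : Pol) (s : S2) : surfaceDiv (gradField q) s = ev (lapS q) s := by
  have hd : HasFDerivAt (gradField q) (fderiv ℝ (gradField q) s) (s : E3) :=
    ((contDiff_gradField q).differentiable (by simp) _).hasFDerivAt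
  have hn : inner ℝ (fderiv ℝ (gradField q) s (s : E3)) (s : E3) = 0 := by
    have h1 := hd.inner ℝ (hasFDerivAt_id (s : E3))
    have h0 : (fun x => inner ℝ (gradField q x) (id x)) = fun _ => (0 : ℝ) := by
      ext x; exact inner_gradField q x
    rw [h0] at h1
    have h2 := congrArg (fun L => L (s : E3)) (h1.unique (hasFDerivAt_const _ _))
    simpa [inner_gradField] using h2
  have ht (i : Fin 3) : (fderiv ℝ (gradField q) s (EuclideanSpace.single i 1)) i
      = fn (pderiv i (radiusSq * pderiv i q - X i * euler q)) s := by
    have h1 := (EuclideanSpace.proj i : E3 →L[ℝ] ℝ).hasFDerivAt.comp (s : E3) hd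
    have h2 := h1.unique (hasFDerivAt_fn (radiusSq * pderiv i q - X i * euler q) (s : E3))
    have h3 := congrArg (fun L => L (EuclideanSpace.single i 1)) h2
    simpa [Pi.single_apply] using h3
  have hp : ∑ i, pderiv i (radiusSq * pderiv i q - X i * euler q) = lapS q := by
    rw [lapS_eq]
    simp only [euler_apply, lap, radiusSq, Fin.sum_univ_three, map_sub,
      map_add, pderiv_mul, pderiv_pow, pderiv_X_self, pderiv_X_of_ne (show (0 : Fin 3) ≠ 1 by decide),
      pderiv_X_of_ne (show (0 : Fin 3) ≠ 2 by decide),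
      pderiv_X_of_ne (show (1 : Fin 3) ≠ 2 by decide),
      pderiv_X_of_ne (show (1 : Fin 3) ≠ 0 by decide),
      pderiv_X_of_ne (show (2 : Fin 3) ≠ 0 by decide),
      pderiv_X_of_ne (show (2 : Fin 3) ≠ 1 by decide)]
    push_cast
    ring
  rw [surfaceDiv, hn, sub_zero, ← hp, map_sum]
  simp [ht, fn_coe]

/-! ### Polynomial subspaces of `L²` and their dimension. -/

/-- The class of a polynomial in `L²(𝕊²)`. -/
noncomputable def toL2 : Pol →ₗ[ℝ] Lp ℝ 2 dS :=
  (ContinuousMap.toLp (E := ℝ) 2 dS ℝ).toLinearMap ∘ₗ ev.toLinearMap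

theorem toL2_apply (p : Pol) : toL2 p = ContinuousMap.toLp (E := ℝ) 2 dS ℝ (ev p) := rfl

theorem inner_toL2 (p q : Pol) : inner ℝ (toL2 p) (toL2 q) = ∫ s, ev (p * q) s ∂dS := by
  rw [toL2_apply, toL2_apply, ContinuousMap.inner_toLp]
  simp [mul_comm]

theorem coeFn_toL2 (p : Pol) : toL2 p =ᵐ[dS] fun s => ev p s :=
  ContinuousMap.coeFn_toLp (𝕜 := ℝ) dS (ev p)

theorem ev_eq_of_toL2_eq {p q : Pol} (h : toL2 p = toL2 q) : ev p = ev q :=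
  ContinuousMap.toLp_injective (𝕜 := ℝ) dS h

theorem toL2_eq_of_ev_eq {p q : Pol} (h : ev p = ev q) : toL2 p = toL2 q := by
  rw [toL2_apply, toL2_apply, h]

/-- Restrictions to the sphere of the polynomials of degree at most `n`. -/
noncomputable def polySpace (n : ℕ) : Submodule ℝ (Lp ℝ 2 dS) :=
  (restrictTotalDegree (Fin 3) ℝ n).map toL2

theorem mem_polySpace {n : ℕ} {v : Lp ℝ 2 dS} :
    v ∈ polySpace n ↔ ∃ p : Pol, p.totalDegree ≤ n ∧ toL2 p = v := by
  simp [polySpace, mem_restrictTotalDegree]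

theorem polySpace_mono : Monotone polySpace := by
  intro m n h v hv
  obtain ⟨p, hp, rfl⟩ := mem_polySpace.1 hv
  exact mem_polySpace.2 ⟨p, hp.trans h, rfl⟩

instance (n : ℕ) : FiniteDimensional ℝ (polySpace n) := by
  unfold polySpace
  infer_instance

/-- The monomial of degree `i` with index `k ≤ 2 i`, of degree at most one in the last variable. -/
noncomputable def sphereMonomial (i k : ℕ) : Pol :=
  if k ≤ i then X 0 ^ k * X 1 ^ (i - k) else X 0 ^ (k - i - 1) * X 1 ^ (2 * i - k) * X 2

/-- Replacing `z²` by `1 - x² - y²` leaves `2i + 1` monomials in each degree `i`, and `∑ (2i + 1) =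
(n + 1)²`. -/
theorem finrank_polySpace_le (n : ℕ) : Module.finrank ℝ (polySpace n) ≤ (n + 1) ^ 2 := by
  classical
  let I : Finset (Σ _ : ℕ, ℕ) := (Finset.range (n + 1)).sigma fun i => Finset.range (2 * i + 1)
  let S : Finset (Lp ℝ 2 dS) := I.image fun x => toL2 (sphereMonomial x.1 x.2)
  have hcard : S.card ≤ (n + 1) ^ 2 := by
    refine Finset.card_image_le.trans (le_of_eq ?_)
    rw [Finset.card_sigma]
    simp only [Finset.card_range]
    induction n with
    | zero => simp
    | succ n ih => rw [Finset.sum_range_succ, ih]; ring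
  have hmem (i k : ℕ) (hi : i ≤ n) (hk : k ≤ 2 * i) :
      toL2 (sphereMonomial i k) ∈ Submodule.span ℝ (S : Set (Lp ℝ 2 dS)) := by
    refine Submodule.subset_span ?_
    refine Finset.mem_coe.2 (Finset.mem_image.2 ⟨⟨i, k⟩, ?_, rfl⟩)
    simp only [I, Finset.mem_sigma, Finset.mem_range]
    omega
  have hmon (c : ℕ) : ∀ a b : ℕ, a + b + c ≤ n →
      toL2 (X 0 ^ a * X 1 ^ b * X 2 ^ c) ∈ Submodule.span ℝ (S : Set (Lp ℝ 2 dS)) := by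
    induction c using Nat.strong_induction_on with
    | _ c ih =>
      intro a b h
      match c, ih, h with
      | 0, _, h =>
        have := hmem (a + b) a (by omega) (by omega)
        rw [sphereMonomial, if_pos (by omega), Nat.add_sub_cancel_left] at this
        simpa using this
      | 1, _, h =>
        have := hmem (a + b + 1) (2 * a + b + 2) (by omega) (by omega)
        rw [sphereMonomial, if_neg (by omega)] at this
        rw [show 2 * a + b + 2 - (a + b + 1) - 1 = a by omega,
          show 2 * (a + b + 1) - (2 * a + b + 2) = b by omega] at this
        simpa using this
      | c + 2, ih, h =>
        have h0 := ih c (by omega) a b (by omega)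
        have h1 := ih c (by omega) (a + 2) b (by omega)
        have h2 := ih c (by omega) a (b + 2) (by omega)
        have he : ev (X 0 ^ a * X 1 ^ b * X 2 ^ (c + 2)) = ev (X 0 ^ a * X 1 ^ b * X 2 ^ c
            - X 0 ^ (a + 2) * X 1 ^ b * X 2 ^ c - X 0 ^ a * X 1 ^ (b + 2) * X 2 ^ c) := by
          have : (X 0 ^ a * X 1 ^ b * X 2 ^ (c + 2) : Pol) = radiusSq * (X 0 ^ a * X 1 ^ b * X 2 ^ c)
            - X 0 ^ (a + 2) * X 1 ^ b * X 2 ^ c - X 0 ^ a * X 1 ^ (b + 2) * X 2 ^ c := by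
            simp only [radiusSq, Fin.sum_univ_three]; ring
          rw [this, map_sub, map_sub, map_mul, ev_radiusSq, one_mul, map_sub, map_sub]
        rw [toL2_eq_of_ev_eq he, map_sub, map_sub]
        exact Submodule.sub_mem _ (Submodule.sub_mem _ h0 h1) h2
  have hle : polySpace n ≤ Submodule.span ℝ (S : Set (Lp ℝ 2 dS)) := by
    intro v hv
    obtain ⟨p, hp, rfl⟩ := mem_polySpace.1 hv
    rw [p.as_sum, map_sum]
    refine Submodule.sum_mem _ fun d hd => ?_
    have h1 := (le_totalDegree hd).trans hp
    rw [Finsupp.sum_fintype _ _ (by simp), Fin.sum_univ_three] at h1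
    rw [monomial_eq, Finsupp.prod_fintype _ _ (by simp), Fin.prod_univ_three, C_mul', map_smul]
    exact Submodule.smul_mem _ _ (hmon _ _ _ h1)
  exact (Submodule.finrank_mono hle).trans ((finrank_span_finset_le_card S).trans hcard)

/-! ### Reproducing kernel and the pointwise bound on projections. -/

theorem exists_ev_comp_sphereMap (R : E3 ≃ₗᵢ[ℝ] E3) {n : ℕ} {p : Pol} (hp : p.totalDegree ≤ n) :
    ∃ q : Pol, q.totalDegree ≤ n ∧ ∀ s, ev q s = ev p (sphereMap R s) := by
  let f : Fin 3 → Pol := fun i => ∑ j, C (R (EuclideanSpace.single j 1) i) * X j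
  refine ⟨aeval f p, ?_, fun s => ?_⟩
  · refine totalDegree_induction (P := fun p => (aeval f p).totalDegree ≤ n) (by simp)
      (fun p q hp hq => ?_) (fun k hk p hp => ?_) hp
    · rw [map_add]
      exact totalDegree_add_le' hp hq
    · have hf : ∀ i, (f i).IsHomogeneous 1 := fun i =>
        IsHomogeneous.sum _ _ _ fun j _ => by
          simpa using (isHomogeneous_C (Fin 3) _).mul (isHomogeneous_X ℝ j)
      exact (hp.aeval f hf).totalDegree_le.trans (by simpa using hk)
  · have hf (i : Fin 3) : eval (fun i => (s : E3) i) (f i) = (R s) i := by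
      have hs : (s : E3) = ∑ j, (s : E3) j • EuclideanSpace.single j (1 : ℝ) := by
        ext k; simp [Finset.sum_apply, Pi.single_apply]
      conv_rhs => rw [hs, map_sum]
      simp [f, mul_comm]
    rw [ev_apply, ev_apply]
    clear hp
    clear_value f
    induction p using MvPolynomial.induction_on with
    | C a => simp
    | add p q hp hq => rw [map_add, map_add, hp, hq, map_add]
    | mul_X p i hp => rw [map_mul, map_mul, hp, aeval_X, hf, map_mul, eval_X, coe_sphereMap]

theorem exists_isometry_apply_eq (x y : S2) : ∃ R : E3 ≃ₗᵢ[ℝ] E3, sphereMap R x = y :=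
  ⟨_, Subtype.ext (Submodule.reflection_sub (v := (x : E3)) (w := (y : E3)) (by simp))⟩

/-- The kernel is `∑ β_k(x) β_k` for an orthonormal basis. Polynomial representatives provide the
point values that `L²` classes lack. -/
theorem exists_reproducingKernel (n : ℕ) : ∃ κ : S2 → Pol, (∀ x, (κ x).totalDegree ≤ n) ∧
    (∀ x (u : Pol), u.totalDegree ≤ n → inner ℝ (toL2 (κ x)) (toL2 u) = ev u x) ∧
    ∫ x, ev (κ x) x ∂dS = Module.finrank ℝ (polySpace n) := by
  let b := stdOrthonormalBasis ℝ (polySpace n)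
  choose β hβ hβb using fun k => mem_polySpace.1 (b k).2
  have hone (k) : ∫ x, ev (β k * β k) x ∂dS = 1 := by
    rw [← inner_toL2, hβb, ← Submodule.coe_inner]
    simp
  refine ⟨fun x => ∑ k, ev (β k) x • β k, fun x => ?_, fun x u hu => ?_, ?_⟩
  · rw [← mem_restrictTotalDegree]
    exact Submodule.sum_mem _ fun k _ => Submodule.smul_mem _ _
      ((mem_restrictTotalDegree _ _ _).2 (hβ k))
  · have h1 := b.sum_repr' ⟨toL2 u, mem_polySpace.2 ⟨u, hu, rfl⟩⟩
    have h2 := congrArg (fun v : polySpace n => (v : Lp ℝ 2 dS)) h1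
    simp only [Submodule.coe_sum, Submodule.coe_smul, Submodule.coe_inner, ← hβb, ← map_smul,
      ← map_sum] at h2
    have h3 := congrArg (fun f => f x) (ev_eq_of_toL2_eq h2)
    simp only [map_sum, map_smul, ContinuousMap.coe_sum, Finset.sum_apply,
      ContinuousMap.coe_smul, Pi.smul_apply, smul_eq_mul] at h3
    rw [← h3, map_sum, sum_inner]
    refine Finset.sum_congr rfl fun k _ => ?_
    rw [map_smul, inner_smul_left]
    simp [mul_comm]
  · have : ∀ x, ev (∑ k, ev (β k) x • β k) x = ∑ k, ev (β k * β k) x := by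
      intro x
      simp
    simp_rw [this]
    rw [integral_finsetSum _ fun k _ => integrable_continuousMap _]
    simp only [hone]
    simp

theorem exists_reproducingKernel_norm_le (n : ℕ) (x : S2) : ∃ κ : Pol, κ.totalDegree ≤ n ∧
    (∀ u : Pol, u.totalDegree ≤ n → inner ℝ (toL2 κ) (toL2 u) = ev u x) ∧
    ‖toL2 κ‖ ^ 2 ≤ ((n : ℝ) + 1) ^ 2 / (4 * Real.pi) := by
  obtain ⟨κ, hdeg, hrep, hint⟩ := exists_reproducingKernel n
  have hdiag (x) : ‖toL2 (κ x)‖ ^ 2 = ev (κ x) x := by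
    rw [← hrep x _ (hdeg x), real_inner_self_eq_norm_sq]
  -- Rotate `κ x` to `q` with `q(y) = ‖κ x‖²`, then apply Cauchy–Schwarz to `⟨κ y, q⟩ = q(y)`. By
  -- symmetry the diagonal is constant, so its integral determines it.
  have hle (x y : S2) : ‖toL2 (κ x)‖ ≤ ‖toL2 (κ y)‖ := by
    obtain ⟨R, hR⟩ := exists_isometry_apply_eq y x
    obtain ⟨q, hq, hqR⟩ := exists_ev_comp_sphereMap R (hdeg x)
    have hnorm : ‖toL2 q‖ = ‖toL2 (κ x)‖ := by
      rw [← sq_eq_sq₀ (norm_nonneg _) (norm_nonneg _), ← real_inner_self_eq_norm_sq,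
        ← real_inner_self_eq_norm_sq, inner_toL2, inner_toL2,
        ← integral_comp_sphereMap R (ev (κ x * κ x))]
      simp [hqR]
    have h1 := hrep y q hq
    rw [hqR, hR, ← hdiag] at h1
    have h2 := real_inner_le_norm (toL2 (κ y)) (toL2 q)
    rw [h1, hnorm, sq] at h2
    rcases (norm_nonneg (toL2 (κ x))).eq_or_lt with h | h
    · rw [← h]; exact norm_nonneg _
    · exact le_of_mul_le_mul_right h2 h
  refine ⟨κ x, hdeg x, hrep x, ?_⟩
  have hconst (y) : ev (κ y) y = ‖toL2 (κ x)‖ ^ 2 := by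
    rw [← hdiag, le_antisymm (hle y x) (hle x y)]
  simp_rw [hconst] at hint
  rw [integral_const, dS_real_univ, smul_eq_mul] at hint
  rw [le_div_iff₀ (by positivity), mul_comm, hint]
  exact_mod_cast finrank_polySpace_le n

/-- Bessel's inequality for the kernel minus its constant part `1/4π`, which the `φ j` do not see;
this turns `(n+1)²` into `(n+1)² - 1`. -/
theorem sum_sq_projection_le {n N : ℕ} {φ : Fin N → Lp ℝ 2 dS} (hφ : Orthonormal ℝ φ)
    (hmean : ∀ j, inner ℝ (φ j) (toL2 1) = 0) {p : Fin N → Pol}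
    (hp : ∀ j, (p j).totalDegree ≤ n)
    (hpφ : ∀ j, toL2 (p j) = (polySpace n).starProjection (φ j)) (x : S2) :
    ∑ j, ev (p j) x ^ 2 ≤ n * (n + 2) / (4 * Real.pi) := by
  obtain ⟨κ, hdeg, hrep, hnorm⟩ := exists_reproducingKernel_norm_le n x
  have hin (j) : inner ℝ (φ j) (toL2 κ - (4 * Real.pi)⁻¹ • toL2 1) = ev (p j) x := by
    rw [inner_sub_right, inner_smul_right, hmean, mul_zero, sub_zero, ← hrep _ (hp j), hpφ,
      real_inner_comm, ← Submodule.inner_starProjection_left_eq_right,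
      Submodule.starProjection_eq_self_iff.2 (mem_polySpace.2 ⟨κ, hdeg, rfl⟩)]
  have h1 := hφ.sum_inner_products_le (s := Finset.univ) (toL2 κ - (4 * Real.pi)⁻¹ • toL2 1)
  simp only [hin, Real.norm_eq_abs, sq_abs] at h1
  refine h1.trans ?_
  have hκ1 := hrep 1 (by simp)
  have h11 : ‖toL2 1‖ ^ 2 = 4 * Real.pi := by
    rw [← real_inner_self_eq_norm_sq, inner_toL2]
    simpa using dS_real_univ
  rw [norm_sub_sq_real, inner_smul_right, hκ1, norm_smul, mul_pow, h11, Real.norm_eq_abs, sq_abs]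
  have hpi := Real.pi_pos
  calc _ ≤ ((n : ℝ) + 1) ^ 2 / (4 * Real.pi) - 2 * ((4 * Real.pi)⁻¹ * 1)
          + (4 * Real.pi)⁻¹ ^ 2 * (4 * Real.pi) := by
        simp only [map_one, ContinuousMap.one_apply]; gcongr
    _ = _ := by field_simp; ring

/-! ### Spectral lower bound for the Dirichlet energy. -/

theorem inner_toLp_eq_integral {E : Type*} [NormedAddCommGroup E] [InnerProductSpace ℝ E]
    {f g : S2 → E} (hf : MemLp f 2 dS) (hg : MemLp g 2 dS) :
    inner ℝ (hf.toLp f) (hg.toLp g) = ∫ s, inner ℝ (f s) (g s) ∂dS := by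
  rw [L2.inner_def]
  refine integral_congr_ae ?_
  filter_upwards [hf.coeFn_toLp, hg.coeFn_toLp] with s h1 h2
  rw [h1, h2]

theorem norm_toLp_sq {E : Type*} [NormedAddCommGroup E] [InnerProductSpace ℝ E]
    {f : S2 → E} (hf : MemLp f 2 dS) : ‖hf.toLp f‖ ^ 2 = ∫ s, ‖f s‖ ^ 2 ∂dS := by
  rw [← real_inner_self_eq_norm_sq, inner_toLp_eq_integral]
  simp

theorem inner_toL2_lapS (p q : Pol) :
    inner ℝ (toL2 (lapS p)) (toL2 q) = inner ℝ (toL2 p) (toL2 (lapS q)) := by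
  rw [inner_toL2, inner_toL2, integral_lapS_mul]

/-- A polynomial of degree at most `m + 1` that is orthogonal to the polynomials of degree at most
`m` is an eigenfunction of the spherical Laplacian. -/
theorem toL2_lapS_of_orthogonal {m : ℕ} {y : Pol} (hy : y.totalDegree ≤ m + 1)
    (horth : ∀ u : Pol, u.totalDegree ≤ m → inner ℝ (toL2 y) (toL2 u) = 0) :
    toL2 (lapS y) = -(((m : ℝ) + 1) * (m + 2)) • toL2 y := by
  obtain ⟨u, hu, huy⟩ := exists_ev_lapS_add hy
  have h := toL2_eq_of_ev_eq huy
  -- The class of `u` is `lapS y` plus a multiple of `y`, hence orthogonal to degree at most `m` by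
  -- symmetry of `lapS`; but `u` itself has such degree.
  have h0 : inner ℝ (toL2 u) (toL2 u) = 0 := by
    nth_rw 1 [← h]
    rw [map_add, map_smul, inner_add_left, inner_smul_left, inner_toL2_lapS, horth u hu,
      horth _ (totalDegree_lapS_le hu)]
    simp
  rw [inner_self_eq_zero.1 h0, map_add, map_smul] at h
  rw [neg_smul]
  exact eq_neg_of_add_eq_zero_left h

theorem memLp_gradField (q : Pol) : MemLp (fun s : S2 => gradField q s) 2 dS := by
  have hc : Continuous fun s : S2 => gradField q s :=
    (contDiff_gradField q).continuous.comp continuous_subtype_val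
  exact hc.memLp_of_hasCompactSupport (HasCompactSupport.of_compactSpace _)

theorem iSup_polySpace_dense : ⊤ ≤ (⨆ n, polySpace n).topologicalClosure := by
  have hsep : ev.range.SeparatesPoints := by
    intro x y hxy
    by_contra! h
    refine hxy (Subtype.ext ?_)
    ext i
    have := h (ev (X i)) ⟨_, ⟨X i, rfl⟩, rfl⟩
    simpa [ev_apply] using this
  have hdense : Dense (Set.range ev) := by
    have := ContinuousMap.subalgebra_topologicalClosure_eq_top_of_separatesPoints _ hsep
    rw [dense_iff_closure_eq]
    have h2 := congrArg (fun A : Subalgebra ℝ C(S2, ℝ) => (A : Set C(S2, ℝ))) this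
    simpa using h2
  have hrange : DenseRange toL2 := by
    have h1 : DenseRange (ContinuousMap.toLp (E := ℝ) 2 (dS) ℝ) :=
      ContinuousMap.toLp_denseRange ℝ dS ℝ (by norm_num)
    exact h1.comp (f := ev) hdense (ContinuousMap.toLp (E := ℝ) 2 dS ℝ).continuous
  intro v _
  have hsub : Set.range toL2 ⊆ ((⨆ n, polySpace n : Submodule ℝ (Lp ℝ 2 dS)) : Set _) := by
    rintro _ ⟨p, rfl⟩
    exact Submodule.mem_iSup_of_mem p.totalDegree (mem_polySpace.2 ⟨p, le_rfl, rfl⟩)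
  exact closure_mono hsub (hrange v)

/-- Bessel's inequality for the gradient. -/
theorem sum_eigenvalue_mul_le {f : S2 → ℝ} {G : S2 → E3} (hf : MemLp f 2 dS)
    (hG : IsWeakGradient f G) (K : ℕ) :
    ∑ m ∈ Finset.range K, (((m : ℝ) + 1) * (m + 2)) *
      ‖(polySpace (m + 1)).starProjection (hf.toLp f)
        - (polySpace m).starProjection (hf.toLp f)‖ ^ 2 ≤ ∫ s, ‖G s‖ ^ 2 ∂dS := by
  set φ := hf.toLp f with hφ
  choose p hp hpφ using fun m : ℕ =>
    mem_polySpace.1 ((polySpace m).starProjection_apply_mem φ)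
  have hproj (m : ℕ) (u : Pol) (hu : u.totalDegree ≤ m) :
      inner ℝ (toL2 (p m)) (toL2 u) = inner ℝ φ (toL2 u) := by
    rw [hpφ, Submodule.inner_starProjection_left_eq_right,
      Submodule.starProjection_eq_self_iff.2 (mem_polySpace.2 ⟨u, hu, rfl⟩)]
  simp only [← hpφ, ← map_sub]
  set y : ℕ → Pol := fun m => p (m + 1) - p m with hy
  have hydeg (m) : (y m).totalDegree ≤ m + 1 :=
    (totalDegree_sub _ _).trans (max_le (hp _) ((hp m).trans (Nat.le_succ m)))
  have hyorth (m : ℕ) (u : Pol) (hu : u.totalDegree ≤ m) : inner ℝ (toL2 (y m)) (toL2 u) = 0 := by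
    rw [map_sub, inner_sub_left, hproj _ _ hu, hproj _ _ (hu.trans (Nat.le_succ m)), sub_self]
  have hφy (m : ℕ) : inner ℝ φ (toL2 (y m)) = ‖toL2 (y m)‖ ^ 2 := by
    rw [← hproj _ _ (hydeg m), ← real_inner_self_eq_norm_sq]
    have h0 := hyorth m (p m) (hp m)
    rw [real_inner_comm] at h0
    have he : toL2 (p (m + 1)) = toL2 (y m) + toL2 (p m) := by simp [hy]
    rw [he, inner_add_left, h0, add_zero]
  -- The sum telescopes to `(P_K - P_0)φ`. Both `⟨G, ∇q⟩` and `‖∇q‖²` equal `A`, so `0 ≤ ‖G - ∇q‖²`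
  -- is the claim.
  set q : Pol := ∑ m ∈ Finset.range K, y m with hq
  have hqp : q = p K - p 0 := Finset.sum_range_sub p K
  have hqy (m : ℕ) (hm : m < K) : inner ℝ (toL2 q) (toL2 (y m)) = ‖toL2 (y m)‖ ^ 2 := by
    have h0 := hyorth m (p 0) ((hp 0).trans (Nat.zero_le m))
    rw [real_inner_comm] at h0
    rw [hqp, map_sub, inner_sub_left, h0, sub_zero, hproj _ _ ((hydeg m).trans hm), hφy]
  set A := ∑ m ∈ Finset.range K, (((m : ℝ) + 1) * (m + 2)) * ‖toL2 (y m)‖ ^ 2 with hA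
  have hlap : toL2 (lapS q) = ∑ m ∈ Finset.range K, -(((m : ℝ) + 1) * (m + 2)) • toL2 (y m) := by
    rw [hq, map_sum, map_sum]
    exact Finset.sum_congr rfl fun m _ => toL2_lapS_of_orthogonal (hydeg m) (hyorth m)
  have h1 : inner ℝ φ (toL2 (lapS q)) = -A := by
    rw [hlap, inner_sum, hA, ← Finset.sum_neg_distrib]
    refine Finset.sum_congr rfl fun m _ => ?_
    rw [inner_smul_right, hφy]
    ring
  have h2 : inner ℝ (toL2 q) (toL2 (lapS q)) = -A := by
    rw [hlap, inner_sum, hA, ← Finset.sum_neg_distrib]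
    refine Finset.sum_congr rfl fun m hm => ?_
    rw [inner_smul_right, hqy m (Finset.mem_range.1 hm)]
    ring
  have h3 : ∫ s, inner ℝ (G s) (gradField q s) ∂dS = A := by
    have := hG.integral_eq _ (isTangentField_gradField q)
    rw [← neg_eq_iff_eq_neg.2 this, neg_eq_iff_eq_neg, ← h1, L2.inner_def]
    refine integral_congr_ae ?_
    filter_upwards [hf.coeFn_toLp, coeFn_toL2 (lapS q)] with s hs1 hs2
    rw [hφ, hs1, hs2, surfaceDiv_gradField]
    simp [mul_comm]
  have h4 : ∫ s : S2, ‖gradField q s‖ ^ 2 ∂dS = A := by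
    simp_rw [norm_gradField_sq]
    rw [integral_gradSq, ← inner_toL2, h2, neg_neg]
  have h5 := sq_nonneg ‖hG.memLp.toLp G - (memLp_gradField q).toLp _‖
  rw [norm_sub_sq_real, inner_toLp_eq_integral, h3, norm_toLp_sq, norm_toLp_sq, h4] at h5
  linarith

theorem norm_sub_projection_sq {m n : ℕ} (h : m ≤ n) (φ : Lp ℝ 2 dS) :
    ‖(polySpace (n + 1)).starProjection φ - (polySpace m).starProjection φ‖ ^ 2 =
      ‖(polySpace n).starProjection φ - (polySpace m).starProjection φ‖ ^ 2 +
      ‖(polySpace (n + 1)).starProjection φ - (polySpace n).starProjection φ‖ ^ 2 := by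
  set v := (polySpace n).starProjection φ - (polySpace m).starProjection φ
  have hv : v ∈ polySpace n := Submodule.sub_mem _ (Submodule.starProjection_apply_mem _ _)
    (polySpace_mono h (Submodule.starProjection_apply_mem _ _))
  have h0 : inner ℝ v
      ((polySpace (n + 1)).starProjection φ - (polySpace n).starProjection φ) = 0 := by
    rw [inner_sub_right, ← Submodule.inner_starProjection_left_eq_right,
      ← Submodule.inner_starProjection_left_eq_right, Submodule.starProjection_eq_self_iff.2 hv,
      Submodule.starProjection_eq_self_iff.2 (polySpace_mono (Nat.le_succ n) hv), sub_self]
  have := norm_add_sq_eq_norm_sq_add_norm_sq_of_inner_eq_zero _ _ h0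
  simp only [sq]
  rw [← this]
  simp [v]

/-- Summation by parts: the weights `2(n+1)` with `n ≤ m` add up to the eigenvalue `(m+1)(m+2)`. -/
theorem sum_norm_sub_projection (φ : Lp ℝ 2 dS) (K : ℕ) :
    ∑ n ∈ Finset.range K, 2 * ((n : ℝ) + 1) *
      ‖(polySpace K).starProjection φ - (polySpace n).starProjection φ‖ ^ 2 =
    ∑ m ∈ Finset.range K, (((m : ℝ) + 1) * (m + 2)) *
      ‖(polySpace (m + 1)).starProjection φ - (polySpace m).starProjection φ‖ ^ 2 := by
  induction K with
  | zero => simp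
  | succ K ih =>
    have hG (K : ℕ) : ∑ n ∈ Finset.range K, 2 * ((n : ℝ) + 1) = K * (K + 1) := by
      induction K with
      | zero => simp
      | succ K ih => rw [Finset.sum_range_succ, ih]; push_cast; ring
    rw [Finset.sum_range_succ, Finset.sum_range_succ _ K, ← ih]
    have : ∀ n ∈ Finset.range K, 2 * ((n : ℝ) + 1) *
        ‖(polySpace (K + 1)).starProjection φ - (polySpace n).starProjection φ‖ ^ 2 =
        2 * ((n : ℝ) + 1) * ‖(polySpace K).starProjection φ - (polySpace n).starProjection φ‖ ^ 2
        + 2 * ((n : ℝ) + 1) *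
        ‖(polySpace (K + 1)).starProjection φ - (polySpace K).starProjection φ‖ ^ 2 := by
      intro n hn
      rw [norm_sub_projection_sq (Finset.mem_range.1 hn).le, mul_add]
    rw [Finset.sum_congr rfl this, Finset.sum_add_distrib, ← Finset.sum_mul, hG]
    ring

theorem sum_norm_sub_projection_le {f : S2 → ℝ} {G : S2 → E3} (hf : MemLp f 2 dS)
    (hG : IsWeakGradient f G) (M : ℕ) :
    ∑ n ∈ Finset.range M, 2 * ((n : ℝ) + 1) *
      ‖hf.toLp f - (polySpace n).starProjection (hf.toLp f)‖ ^ 2 ≤ ∫ s, ‖G s‖ ^ 2 ∂dS := by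
  -- With `M` fixed, `K → ∞` replaces `P_K` by the identity.
  have hlim := Submodule.starProjection_tendsto_self polySpace polySpace_mono (hf.toLp f)
    iSup_polySpace_dense
  have hlim2 : Tendsto (fun K => ∑ n ∈ Finset.range M, 2 * ((n : ℝ) + 1) *
      ‖(polySpace K).starProjection (hf.toLp f) - (polySpace n).starProjection (hf.toLp f)‖ ^ 2)
      atTop (𝓝 (∑ n ∈ Finset.range M, 2 * ((n : ℝ) + 1) *
      ‖hf.toLp f - (polySpace n).starProjection (hf.toLp f)‖ ^ 2)) :=
    tendsto_finsetSum _ fun n _ => (((hlim.sub_const _).norm).pow 2).const_mul _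
  refine le_of_tendsto hlim2 ?_
  filter_upwards [eventually_ge_atTop M] with K hK
  refine le_trans ?_ (sum_eigenvalue_mul_le hf hG K)
  rw [← sum_norm_sub_projection]
  refine Finset.sum_le_sum_of_subset_of_nonneg (Finset.range_subset_range.2 hK) fun n _ _ => ?_
  positivity

/-! ### Layer-cake inequality and other real-variable tools. -/

/-- The quartic is the primitive of `2s(r - s)²`, and `(r - s)² ≤ (r - t)²` on `[t, u]`. -/
theorem quartic_sub_le {t u r : ℝ} (ht : 0 ≤ t) (htu : t ≤ u) (hur : u ≤ r) :
    (r ^ 2 * u ^ 2 - 4 / 3 * r * u ^ 3 + u ^ 4 / 2) -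
      (r ^ 2 * t ^ 2 - 4 / 3 * r * t ^ 3 + t ^ 4 / 2) ≤ (u ^ 2 - t ^ 2) * (r - t) ^ 2 := by
  obtain ⟨d, rfl⟩ : ∃ d, u = t + d := ⟨u - t, by ring⟩
  obtain ⟨e, rfl⟩ : ∃ e, r = t + d + e := ⟨r - (t + d), by ring⟩
  have hd : 0 ≤ d := by linarith
  have he : 0 ≤ e := by linarith
  rw [← sub_nonneg]
  have : ((t + d) ^ 2 - t ^ 2) * (t + d + e - t) ^ 2 -
      (((t + d + e) ^ 2 * (t + d) ^ 2 - 4 / 3 * (t + d + e) * (t + d) ^ 3 + (t + d) ^ 4 / 2) -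
      ((t + d + e) ^ 2 * t ^ 2 - 4 / 3 * (t + d + e) * t ^ 3 + t ^ 4 / 2)) =
      4 / 3 * d ^ 3 * t + 2 * d ^ 2 * e * t + 5 / 6 * d ^ 4 + 4 / 3 * d ^ 3 * e := by ring
  rw [this]
  positivity

/-- The layer-cake inequality: a discrete form of `∫ (r - √(c E))₊² dE = r⁴ / (6 c)`. -/
theorem pow_four_le_sum {c r : ℝ} (hc : 0 ≤ c) (hr : 0 ≤ r) {C : ℕ → ℝ}
    (hC : ∀ n : ℕ, C n ≤ c * (n * (n + 1))) {M : ℕ} (hM : r ^ 2 ≤ c * (M * (M + 1))) :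
    r ^ 4 ≤ 6 * c * ∑ n ∈ Finset.range M, 2 * ((n : ℝ) + 1) * max (r - √(C n)) 0 ^ 2 := by
  -- Partition points of `[0, r]`: before the cut at `r`, `τ²` grows by at most `2c(n+1)`;
  -- afterwards by nothing. The telescoped sum is `g r = r⁴/6`.
  let τ : ℕ → ℝ := fun n => min √(c * (n * (n + 1))) r
  let g : ℝ → ℝ := fun t => r ^ 2 * t ^ 2 - 4 / 3 * r * t ^ 3 + t ^ 4 / 2
  have hstep (n : ℕ) : g (τ (n + 1)) - g (τ n) ≤
      c * (2 * ((n : ℝ) + 1) * max (r - √(C n)) 0 ^ 2) := by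
    have h0 : 0 ≤ τ n := le_min (Real.sqrt_nonneg _) hr
    have hmono : τ n ≤ τ (n + 1) := by
      refine min_le_min_right _ (Real.sqrt_le_sqrt ?_)
      push_cast
      gcongr <;> linarith
    refine (quartic_sub_le h0 hmono (min_le_right _ _)).trans ?_
    rcases le_total √(c * (n * (n + 1))) r with h | h
    · have hτ : τ n = √(c * (n * (n + 1))) := min_eq_left h
      have h1 : τ (n + 1) ^ 2 ≤ c * ((n + 1) * (n + 2)) := by
        calc τ (n + 1) ^ 2 ≤ √(c * ((n + 1 : ℕ) * ((n + 1 : ℕ) + 1))) ^ 2 :=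
              pow_le_pow_left₀ (h0.trans hmono) (min_le_left _ _) 2
          _ = c * ((n + 1) * (n + 2)) := by
              rw [Real.sq_sqrt (by positivity)]; push_cast; ring
      have h2 : τ n ^ 2 = c * (n * (n + 1)) := by rw [hτ, Real.sq_sqrt (by positivity)]
      have h3 : r - τ n ≤ max (r - √(C n)) 0 :=
        le_max_of_le_left (sub_le_sub_left (hτ ▸ Real.sqrt_le_sqrt (hC n)) _)
      have h4 : 0 ≤ r - τ n := sub_nonneg.2 (min_le_right _ _)
      calc _ ≤ (c * (2 * ((n : ℝ) + 1))) * max (r - √(C n)) 0 ^ 2 := by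
            gcongr
            linarith
        _ = _ := by ring
    · have hτ : τ n = r := min_eq_right h
      rw [hτ, sub_self]
      simp only [ne_eq, OfNat.ofNat_ne_zero, not_false_eq_true, zero_pow, mul_zero]
      positivity
  have hsum := Finset.sum_le_sum fun n (_ : n ∈ Finset.range M) => hstep n
  rw [Finset.sum_range_sub (fun n => g (τ n)), ← Finset.mul_sum] at hsum
  have hτ0 : τ 0 = 0 := by simp [τ, hr]
  have hτM : τ M = r := min_eq_right (Real.le_sqrt_of_sq_le hM)
  rw [hτ0, hτM] at hsum
  simp only [g] at hsum
  nlinarith [hsum]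

/-- Reverse triangle inequality in `ℝ^N`. -/
theorem max_sub_sq_le_sum {N : ℕ} (a b : Fin N → ℝ) {C : ℝ} (hb : ∑ j, b j ^ 2 ≤ C) :
    max (√(∑ j, a j ^ 2) - √C) 0 ^ 2 ≤ ∑ j, (a j - b j) ^ 2 := by
  have hn (v : Fin N → ℝ) : ‖(WithLp.toLp 2 v : EuclideanSpace ℝ (Fin N))‖ = √(∑ j, v j ^ 2) := by
    simp [EuclideanSpace.norm_eq]
  have h1 := norm_sub_norm_le (WithLp.toLp 2 a : EuclideanSpace ℝ (Fin N)) (WithLp.toLp 2 b)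
  rw [← WithLp.toLp_sub, hn, hn, hn] at h1
  have h2 := Real.sqrt_le_sqrt hb
  simp only [Pi.sub_apply] at h1
  have h3 : max (√(∑ j, a j ^ 2) - √C) 0 ≤ √(∑ j, (a j - b j) ^ 2) :=
    max_le (by linarith) (Real.sqrt_nonneg _)
  calc _ ≤ √(∑ j, (a j - b j) ^ 2) ^ 2 := pow_le_pow_left₀ (le_max_right _ _) h3 2
    _ = _ := Real.sq_sqrt (Finset.sum_nonneg fun _ _ => sq_nonneg _)

/-- Fatou's lemma for real functions with bounded integrals that eventually dominate `h`. -/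
theorem integrable_and_integral_le_of_eventually_le {h : S2 → ℝ} {F : ℕ → S2 → ℝ} {D : ℝ}
    (hm : AEStronglyMeasurable h dS) (h0 : ∀ s, 0 ≤ h s) (hF0 : ∀ n s, 0 ≤ F n s)
    (hF : ∀ n, Integrable (F n) dS) (hD : ∀ n, ∫ s, F n s ∂dS ≤ D)
    (hle : ∀ s, ∀ᶠ n in atTop, h s ≤ F n s) :
    Integrable h dS ∧ ∫ s, h s ∂dS ≤ D := by
  have hD0 : 0 ≤ D := (integral_nonneg (hF0 0)).trans (hD 0)
  have hlint : ∫⁻ s, ENNReal.ofReal (h s) ∂dS ≤ ENNReal.ofReal D := by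
    calc ∫⁻ s, ENNReal.ofReal (h s) ∂dS
        ≤ ∫⁻ s, liminf (fun n => ENNReal.ofReal (F n s)) atTop ∂dS := by
          refine lintegral_mono fun s => le_liminf_of_le (by isBoundedDefault) ?_
          filter_upwards [hle s] with n hn
          exact ENNReal.ofReal_le_ofReal hn
      _ ≤ liminf (fun n => ∫⁻ s, ENNReal.ofReal (F n s) ∂dS) atTop :=
          lintegral_liminf_le' fun n => (hF n).aemeasurable.ennreal_ofReal
      _ ≤ ENNReal.ofReal D := by
          refine liminf_le_of_le (by isBoundedDefault) fun b hb => ?_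
          obtain ⟨n, hn⟩ := hb.exists
          refine hn.trans ?_
          rw [← ofReal_integral_eq_lintegral_ofReal (hF n) (ae_of_all _ (hF0 n))]
          exact ENNReal.ofReal_le_ofReal (hD n)
  refine ⟨⟨hm, ?_⟩, ?_⟩
  · rw [hasFiniteIntegral_iff_ofReal (ae_of_all _ h0)]
    exact hlint.trans_lt ENNReal.ofReal_lt_top
  · rw [integral_eq_lintegral_of_nonneg_ae (ae_of_all _ h0) hm]
    exact ENNReal.toReal_le_of_le_ofReal hD0 hlint

end SphereLT

/-! ### Assembly of the inequality. -/

open SphereLT Filter in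
/-- The weak gradient `G j` of `ψ j` is unique up to a null set; the inequality is asserted for any
representative of it. -/
theorem theorem2p1 (N : ℕ) (ψ : Fin N → SphereLT.S2 → ℝ) (G : Fin N → SphereLT.S2 → SphereLT.E3)
    (hψ : ∀ j, SphereLT.MemH1 (ψ j))
    (hG : ∀ j, SphereLT.IsWeakGradient (ψ j) (G j))
    (horth : ∀ i j, ∫ s, ψ i s * ψ j s ∂SphereLT.dS = if i = j then 1 else 0)
    (hmean : ∀ j, ∫ s, ψ j s ∂SphereLT.dS = 0) :
    Integrable (fun s => (∑ j, ψ j s ^ 2) ^ 2) SphereLT.dS ∧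
      ∫ s, (∑ j, ψ j s ^ 2) ^ 2 ∂SphereLT.dS ≤
        9 / (4 * Real.pi) * ∑ j, ∫ s, ‖G j s‖ ^ 2 ∂SphereLT.dS := by
  have hpi := Real.pi_pos
  have hL (j) : MemLp (ψ j) 2 dS := (hψ j).1
  let φ : Fin N → Lp ℝ 2 dS := fun j => (hL j).toLp (ψ j)
  have hφ : Orthonormal ℝ φ := by
    rw [orthonormal_iff_ite]
    intro i j
    rw [← horth i j, inner_toLp_eq_integral]
    simp [mul_comm]
  have hφ1 (j) : inner ℝ (φ j) (toL2 1) = 0 := by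
    rw [← hmean j, L2.inner_def]
    refine integral_congr_ae ?_
    filter_upwards [(hL j).coeFn_toLp, coeFn_toL2 1] with s h1 h2
    rw [h1, h2]
    simp
  choose p hp hpφ using fun (n : ℕ) (j : Fin N) =>
    mem_polySpace.1 ((polySpace n).starProjection_apply_mem (φ j))
  have hdiff (n j) : MemLp (fun s => ψ j s - ev (p n j) s) 2 dS :=
    (hL j).sub ((ev (p n j)).continuous.memLp_of_hasCompactSupport
      (HasCompactSupport.of_compactSpace _))
  have hint (n j) : ∫ s, (ψ j s - ev (p n j) s) ^ 2 ∂dS =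
      ‖φ j - (polySpace n).starProjection (φ j)‖ ^ 2 := by
    have : (hdiff n j).toLp _ = φ j - toL2 (p n j) := by
      apply Lp.ext
      filter_upwards [(hdiff n j).coeFn_toLp, (hL j).coeFn_toLp, coeFn_toL2 (p n j),
        Lp.coeFn_sub (φ j) (toL2 (p n j))] with s h1 h2 h3 h4
      rw [h1, h4, Pi.sub_apply, h2, h3]
    rw [← hpφ, ← this, norm_toLp_sq]
    simp
  -- The least `c` with `n(n+2)/4π ≤ c n(n+1)` for all natural `n`; equality at `n = 1`.
  set c : ℝ := 3 / (8 * Real.pi) with hc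
  have hc0 : 0 < c := by positivity
  -- `F M s` dominates `ρ(s)²` once `c M(M+1) ≥ ρ(s)`; this threshold depends on `s`, hence Fatou.
  let F : ℕ → S2 → ℝ := fun M s => 6 * c * ∑ n ∈ Finset.range M,
    2 * ((n : ℝ) + 1) * ∑ j, (ψ j s - ev (p n j) s) ^ 2
  have hterm (n : ℕ) : Integrable
      (fun s => 2 * ((n : ℝ) + 1) * ∑ j, (ψ j s - ev (p n j) s) ^ 2) dS :=
    (integrable_finsetSum _ fun j _ => (hdiff n j).integrable_sq).const_mul _
  refine integrable_and_integral_le_of_eventually_le (F := F) ?_ (fun s => sq_nonneg _)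
    (fun M s => by positivity) (fun M => (integrable_finsetSum _ fun n _ => hterm n).const_mul _)
    (fun M => ?_) (fun s => ?_)
  · exact (Finset.aestronglyMeasurable_fun_sum _ fun j _ =>
      (hL j).aestronglyMeasurable.pow 2).pow 2
  · have h6 : 6 * c = 9 / (4 * Real.pi) := by rw [hc]; field_simp; norm_num
    simp only [F]
    rw [integral_const_mul, h6, integral_finsetSum _ fun n _ => hterm n]
    gcongr
    have : ∀ n ∈ Finset.range M,
        ∫ s, 2 * ((n : ℝ) + 1) * ∑ j, (ψ j s - ev (p n j) s) ^ 2 ∂dS =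
        ∑ j, 2 * ((n : ℝ) + 1) * ‖φ j - (polySpace n).starProjection (φ j)‖ ^ 2 := by
      intro n _
      rw [integral_const_mul, integral_finsetSum _ fun j _ => (hdiff n j).integrable_sq,
        Finset.mul_sum]
      simp_rw [hint]
    rw [Finset.sum_congr rfl this, Finset.sum_comm]
    exact Finset.sum_le_sum fun j _ => sum_norm_sub_projection_le (hL j) (hG j) M
  · have hlim : Tendsto (fun M : ℕ => c * ((M : ℝ) * (M + 1))) atTop atTop :=
      (tendsto_natCast_atTop_atTop.atTop_mul_atTop₀
        (tendsto_atTop_add_const_right _ _ tendsto_natCast_atTop_atTop)).const_mul_atTop hc0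
    filter_upwards [hlim.eventually_ge_atTop (∑ j, ψ j s ^ 2)] with M hM
    have hρ : 0 ≤ ∑ j, ψ j s ^ 2 := Finset.sum_nonneg fun j _ => sq_nonneg _
    have hC (n : ℕ) : (n : ℝ) * (n + 2) / (4 * Real.pi) ≤ c * (n * (n + 1)) := by
      -- The bound is equivalent to `n ≤ n²`, so integrality of `n` is essential.
      have hn : (n : ℝ) ≤ n ^ 2 := by exact_mod_cast Nat.le_self_pow two_ne_zero n
      rw [hc, div_mul_eq_mul_div, div_le_div_iff₀ (by positivity) (by positivity)]
      nlinarith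
    have h1 := pow_four_le_sum hc0.le (Real.sqrt_nonneg (∑ j, ψ j s ^ 2)) hC
      (M := M) (by rwa [Real.sq_sqrt hρ])
    rw [show √(∑ j, ψ j s ^ 2) ^ 4 = (√(∑ j, ψ j s ^ 2) ^ 2) ^ 2 by ring, Real.sq_sqrt hρ] at h1
    refine h1.trans ?_
    simp only [F]
    gcongr with n _
    exact max_sub_sq_le_sum _ _ (sum_sq_projection_le hφ hφ1 (hp n) (hpφ n) s)
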